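/- Let $\mathfrak g$ be a finite-dimensional complex simple Lie algebra, with a Cartan subalgebra, a set of simple roots, and a nondegenerate invariant symmetric bilinear form; Casimir operators are taken with respect to this form. Let $\beta_1=\alpha_0$ be the highest root, and for $2\le i\le k$ let $\beta_i$ be a highest (that is, maximal) element among the long roots orthogonal to $\beta_1,\dots,\beta_{i-1}$. Put $\sigma_i=\beta_1+\cdots+\beta_i$ and suppose that $\sigma_i$ is dominant for every $i\le k$, where $k\ge 1$. Let $2t$ be the Casimir eigenvalue of the adjoint representation and, if $k\ge 2$, let $\beta$ be Vogel's parameter, defined by the condition that the irreducible component $Y_2(\beta)$ of $S^2\mathfrak g$ of highest weight $\alpha_0+\beta_2$ has Casimir eigenvalue $4t-2\beta$. Let $Y_k(\beta)$ be an irreducible component of $S^k\mathfrak g$ of highest weight $\sigma_k$. Then the Casimir operator acts on $Y_k(\beta)$ as the scalar $$2kt-k(k-1)\beta .$$ (For $k=1$ the term with $\beta$ vanishes, and no parameter $\beta$ is needed.) -/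

import Mathlib

open LieAlgebra LieModule Module

noncomputable section

namespace CasimirSeries

/-! ### The symmetric powers of a Lie algebra as Lie modules -/

section SymmetricPowers

variable {L : Type*} [LieRing L] [LieAlgebra ℂ L]

/-- `p ↦ p + ε (x · p)`, as an algebra map to the dual numbers over the symmetric algebra. -/
def adDual (x : L) : SymmetricAlgebra ℂ L →ₐ[ℂ] DualNumber (SymmetricAlgebra ℂ L) :=
  SymmetricAlgebra.lift
    ((TrivSqZeroExt.inlAlgHom ℂ (SymmetricAlgebra ℂ L) (SymmetricAlgebra ℂ L)).toLinearMap ∘ₗ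
        SymmetricAlgebra.ι ℂ L +
      (TrivSqZeroExt.inrHom (SymmetricAlgebra ℂ L) (SymmetricAlgebra ℂ L)).restrictScalars ℂ ∘ₗ
        SymmetricAlgebra.ι ℂ L ∘ₗ (LieAlgebra.ad ℂ L x : L →ₗ[ℂ] L))

lemma adDual_ι (x y : L) : adDual x (SymmetricAlgebra.ι ℂ L y) =
    TrivSqZeroExt.inl (SymmetricAlgebra.ι ℂ L y) +
      TrivSqZeroExt.inr (SymmetricAlgebra.ι ℂ L ⁅x, y⁆) := by
  simp [adDual]

lemma fst_adDual (x : L) (p : SymmetricAlgebra ℂ L) : (adDual x p).fst = p := by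
  have h : (TrivSqZeroExt.fstHom ℂ (SymmetricAlgebra ℂ L) (SymmetricAlgebra ℂ L)).comp
      (adDual x) = AlgHom.id ℂ _ := by
    apply SymmetricAlgebra.algHom_ext
    ext y
    simp [adDual_ι]
  exact congr($h p)

/-- The derivation of the symmetric algebra of `L` which extends `ad x`. -/
def adDer (x : L) : Derivation ℂ (SymmetricAlgebra ℂ L) (SymmetricAlgebra ℂ L) :=
  Derivation.mk' ((TrivSqZeroExt.sndHom (SymmetricAlgebra ℂ L)
      (SymmetricAlgebra ℂ L)).restrictScalars ℂ ∘ₗ (adDual x).toLinearMap) (by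
    intro p q
    simp [fst_adDual, TrivSqZeroExt.snd_mul, mul_comm q])

@[simp] lemma adDer_ι (x y : L) :
    adDer x (SymmetricAlgebra.ι ℂ L y) = SymmetricAlgebra.ι ℂ L ⁅x, y⁆ := by
  simp [adDer, adDual_ι]

lemma derivation_ext {D E : Derivation ℂ (SymmetricAlgebra ℂ L) (SymmetricAlgebra ℂ L)}
    (h : ∀ y : L, D (SymmetricAlgebra.ι ℂ L y) = E (SymmetricAlgebra.ι ℂ L y)) : D = E := by
  ext p
  induction p using SymmetricAlgebra.induction with
  | algebraMap r => simp
  | ι y => exact h y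
  | mul a b ha hb => simp [ha, hb]
  | add a b ha hb => simp [ha, hb]

lemma adDer_add (x y : L) : adDer (x + y) = adDer x + adDer y :=
  derivation_ext fun z ↦ by simp

lemma adDer_smul (c : ℂ) (x : L) : adDer (c • x) = c • adDer x :=
  derivation_ext fun z ↦ by simp

lemma adDer_lie (x y : L) : adDer ⁅x, y⁆ = ⁅adDer x, adDer y⁆ :=
  derivation_ext fun z ↦ by simp [Derivation.commutator_apply]

/-- `L` acts on its symmetric algebra by the derivations that extend the adjoint action. -/
instance : LieRingModule L (SymmetricAlgebra ℂ L) where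
  bracket x p := adDer x p
  add_lie x y p := by simp [adDer_add]
  lie_add x p q := map_add _ _ _
  leibniz_lie x y p := by simp [adDer_lie, Derivation.commutator_apply]

lemma lie_def (x : L) (p : SymmetricAlgebra ℂ L) : ⁅x, p⁆ = adDer x p := rfl

instance : LieModule ℂ L (SymmetricAlgebra ℂ L) where
  smul_lie c x p := by simp [lie_def, adDer_smul]
  lie_smul c x p := by simp [lie_def]

variable (L) in
/-- The `k`-th symmetric power of `L`: the span of the products of `k` elements of `L` in the
symmetric algebra of `L`. -/
def symPower (k : ℕ) : LieSubmodule ℂ L (SymmetricAlgebra ℂ L) where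
  toSubmodule := LinearMap.range (SymmetricAlgebra.ι ℂ L) ^ k
  lie_mem := by
    intro x p hp
    change adDer x p ∈ LinearMap.range (SymmetricAlgebra.ι ℂ L) ^ k
    induction k generalizing p with
    | zero =>
      rw [pow_zero] at hp
      obtain ⟨r, rfl⟩ := Submodule.mem_one.1 hp
      simp
    | succ k ih =>
      replace hp : p ∈ LinearMap.range (SymmetricAlgebra.ι ℂ L) ^ (k + 1) := hp
      rw [pow_succ] at hp ⊢
      induction hp using Submodule.mul_induction_on' with
      | mem_mul_mem a ha b hb =>
        obtain ⟨y, rfl⟩ := hb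
        rw [Derivation.leibniz, smul_eq_mul, smul_eq_mul, mul_comm _ (adDer x a)]
        refine add_mem (Submodule.mul_mem_mul ha ?_) (Submodule.mul_mem_mul (ih ha) ⟨y, rfl⟩)
        rw [adDer_ι]
        exact ⟨_, rfl⟩
      | add a _ b _ iha ihb => rw [map_add]; exact add_mem iha ihb

end SymmetricPowers

/-! ### Casimir eigenvalues -/

section Casimir

variable {L : Type*} [LieRing L] [LieAlgebra ℂ L] [FiniteDimensional ℂ L]
  (Φ : LinearMap.BilinForm ℂ L) (hΦ : Φ.Nondegenerate)
  (M : Type*) [AddCommGroup M] [Module ℂ M] [LieRingModule L M] [LieModule ℂ L M]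

/-- The Casimir operator `∑ i, xᵢ xⁱ` on the module `M`, where `xᵢ` is a basis of `L`
and `xⁱ` is the dual basis with respect to the form `Φ`. -/
def casimir : M →ₗ[ℂ] M :=
  ∑ i, toEnd ℂ L M (finBasis ℂ L i) ∘ₗ toEnd ℂ L M (Φ.dualBasis hΦ (finBasis ℂ L) i)

/-- The Casimir operator acts on `M` as the scalar `c`. -/
def HasCasimirEigenvalue (c : ℂ) : Prop := ∀ m : M, casimir Φ hΦ M m = c • m

end Casimir

/-! ### Roots -/

section Roots

variable {ι R M N : Type*} [Finite ι] [CommRing R] [CharZero R] [IsDomain R]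
  [AddCommGroup M] [Module R M] [AddCommGroup N] [Module R N]
  {P : RootPairing ι R M N} [P.IsCrystallographic]

/-- The partial order on roots: `i ≤ j` if `j - i` is a sum of simple roots. -/
def RootLE (b : P.Base) (i j : ι) : Prop :=
  P.root j - P.root i ∈ AddSubmonoid.closure (P.root '' b.support)

variable (P) in
/-- A root is long if no root is longer. -/
def IsLong (i : ι) : Prop :=
  letI := Fintype.ofFinite ι
  ∀ j, (P.posRootForm ℤ).rootLength j ≤ (P.posRootForm ℤ).rootLength i

/-- `β 0` is the highest root, and each further `β m` is a highest (that is, maximal) element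
among the long roots which are orthogonal to all the previous ones. -/
structure IsHighestOrthogonalSequence (b : P.Base) {k : ℕ} (β : Fin k → ι) : Prop where
  first : ∀ m : Fin k, m.val = 0 → ∀ j, RootLE b j (β m)
  long : ∀ m, IsLong P (β m)
  orthogonal : ∀ m m', m' < m → P.IsOrthogonal (β m) (β m')
  highest : ∀ m j, IsLong P j → (∀ m' < m, P.IsOrthogonal j (β m')) → RootLE b (β m) j → j = β m

/-- The sum `β 0 + ⋯ + β m`. -/
def partialSum {k : ℕ} (β : Fin k → ι) (m : Fin k) : M := ∑ m' ∈ Finset.Iic m, P.root (β m')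

/-- A weight is dominant if it takes values in the natural numbers on the simple coroots. -/
def IsDominant (b : P.Base) (μ : M) : Prop :=
  ∀ i ∈ b.support, ∃ n : ℕ, P.toLinearMap μ (P.coroot i) = n

end Roots

/-! ### Highest weights and Vogel's parameter -/

section HighestWeight

variable {L : Type*} [LieRing L] [LieAlgebra ℂ L] [FiniteDimensional ℂ L] [IsSimple ℂ L]
  {H : LieSubalgebra ℂ L} [H.IsCartanSubalgebra] (b : (IsKilling.rootSystem H).Base)

/-- The module `M` contains a highest weight vector of weight `μ`, relative to the positive roots
given by the base `b`. -/
def HasHighestWeightVector (M : Type*) [AddCommGroup M] [Module ℂ M] [LieRingModule L M]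
    (μ : Dual ℂ H) : Prop :=
  ∃ v : M, v ≠ 0 ∧ (∀ h : H, ⁅(h : L), v⁆ = μ h • v) ∧
    ∀ α : H.root, b.IsPos α → ∀ x ∈ rootSpace H α.1, ⁅x, v⁆ = 0

/-- `Y` is an irreducible component of the `k`-th symmetric power of `L`, of highest
weight `μ`. -/
structure IsComponent (k : ℕ) (μ : Dual ℂ H) (Y : LieSubmodule ℂ L (SymmetricAlgebra ℂ L)) :
    Prop where
  le : Y ≤ symPower L k
  irreducible : LieModule.IsIrreducible ℂ L Y
  highestWeight : HasHighestWeightVector b Y μ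

/-- Vogel's parameter attached to the component `Y₂` of highest weight `α₀ + α'` of the symmetric
square of `L`, where `α₀` is the highest root, `α'` is a highest long root orthogonal to `α₀`, and
`2 t` is the Casimir eigenvalue of `L`: the Casimir eigenvalue of `Y₂` is `4 t - 2 β`. -/
def IsVogelParameter (Φ : LinearMap.BilinForm ℂ L) (hΦ : Φ.Nondegenerate) (t β : ℂ)
    (α₀ α' : H.root) : Prop :=
  ∃ Y₂ : LieSubmodule ℂ L (SymmetricAlgebra ℂ L),
    IsComponent b 2 ((IsKilling.rootSystem H).root α₀ + (IsKilling.rootSystem H).root α') Y₂ ∧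
      HasCasimirEigenvalue Φ hΦ Y₂ (4 * t - 2 * β)

end HighestWeight

end CasimirSeries

end

noncomputable section

namespace CasimirSeries

/-! ### Long roots and orthogonal sequences in a root system. -/

section RootPairings

variable {ι R M N : Type*} [Fintype ι] [Field R] [CharZero R]
  [AddCommGroup M] [Module R M] [AddCommGroup N] [Module R N]
  {P : RootPairing ι R M N} [P.IsCrystallographic]

/-! On a highest weight vector of weight `λ` the Casimir operator acts by `(λ, λ + 2ρ)`. For `λ` a
sum of mutually orthogonal long roots `βᵢ` this equals `∑ ((βᵢ, βᵢ) + (βᵢ, 2ρ))`, and all `(βᵢ, βᵢ)`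
agree. The theorem thus reduces to the claim that the numbers `(βᵢ, 2ρ)` form an arithmetic
progression: the eigenvalue is then `∑ (c - i d)` over `0 ≤ i < k`. The adjoint representation gives
`c = 2t`, the component `Y₂` gives `2c - d = 4t - 2β`, and summation finishes.

For the progression, dominance of the partial sums makes the sign of the first nonzero pairing of a
root with the `βₗ` decide its positivity. So `a ↦ -s_{βₘ} a` permutes the positive roots whose first
nonzero pairing is with `βₘ`, and for `m < i` it negates their pairing with `βᵢ`. These roots cancel
(`sum_isPos_step`), and `two_mul_sum_isPos` leaves a sum of absolute values over the roots
orthogonal to all earlier `βₗ`.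

Since a root meets at most two of the `βₗ` (`pairingIn_eq_zero_of_ne_zero`), that sum is a total
over all roots minus one correction for each `l < i`. Weyl group elements exchanging members of the
sequence up to sign (`exists_perm_swap`) show that the totals agree and the corrections agree
(`exists_sum_isPos_eq`). -/

variable (P) in
lemma exists_rootLength : ∃ ℓ : ι → ℤ, (∀ i, 0 < ℓ i) ∧
    (∀ i j, P.pairingIn ℤ j i * ℓ i = P.pairingIn ℤ i j * ℓ j) ∧
    ∀ i, IsLong P i → ∀ j, ℓ j ≤ ℓ i := by
  let _ := Fintype.ofFinite ι
  exact ⟨(P.posRootForm ℤ).rootLength, fun i ↦ (P.posRootForm ℤ).rootLength_pos i,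
    fun i j ↦ (P.posRootForm ℤ).pairingIn_mul_eq_pairingIn_mul_swap i j, fun i h j ↦ h j⟩

omit [Fintype ι] in
lemma pairingIn_reflectionPerm_left (i j k : ι) :
    P.pairingIn ℤ (P.reflectionPerm i j) k =
      P.pairingIn ℤ j k - P.pairingIn ℤ j i * P.pairingIn ℤ i k := by
  have : P.pairing (P.reflectionPerm i j) k = P.pairing j k - P.pairing j i * P.pairing i k := by
    rw [RootPairing.pairing, RootPairing.root', ← P.reflectionPerm_root]
    rw [map_sub, map_smul, LinearMap.sub_apply, LinearMap.smul_apply, smul_eq_mul]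
    rfl
  simp only [← P.algebraMap_pairingIn ℤ] at this
  exact_mod_cast this

/-- A pairing of 2 or 3 whose opposite pairing is 1 would make `j` longer than the long root `i`;
the remaining case (2, 2) forces equality. -/
lemma pairingIn_le_one_of_isLong [P.IsReduced] {i j : ι} (hi : IsLong P i) (hij : j ≠ i) :
    P.pairingIn ℤ j i ≤ 1 := by
  obtain ⟨ℓ, hpos, hswap, hle⟩ := exists_rootLength P
  have h1 := hpos i
  have h2 := hle i hi j
  have h3 := hswap i j
  have h4 := P.pairingIn_pairingIn_mem_set_of_isCrystal_of_isRed j i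
  simp only [Set.mem_insert_iff, Set.mem_singleton_iff, Prod.mk.injEq] at h4
  by_contra! h
  have h5 : P.pairingIn ℤ j i = 2 ∧ P.pairingIn ℤ i j = 2 := by
    rcases h4 with h | h | h | h | h | h | h | h | h | h | h | h | h <;>
      first
      | exact h
      | (rw [h.1, h.2] at h3; omega)
  have _ : Module.IsReflexive R M := .of_isPerfPair P.toLinearMap
  have _ : Module.IsReflexive R N := .of_isPerfPair P.flip.toLinearMap
  exact hij ((P.pairingIn_two_two_iff ℤ j i).1 h5)

lemma neg_one_le_pairingIn_of_isLong [P.IsReduced] {i j : ι} (hi : IsLong P i)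
    (hij : j ≠ P.reflectionPerm i i) : -1 ≤ P.pairingIn ℤ j i := by
  have : P.reflectionPerm j j ≠ i := by
    rintro rfl
    apply hij
    exact (P.root_eq_neg_iff).1 (by simp)
  have := pairingIn_le_one_of_isLong hi this
  rw [P.pairingIn_reflectionPerm_self_left] at this
  omega

/-- The roots not orthogonal to `i` span a subspace stable under every reflection `s_d`: either `d`
is among them, or `s_d` preserves pairings with `i`. By irreducibility they span everything, so they
cannot all be orthogonal to `j`. -/
lemma exists_pairingIn_ne_zero [P.IsIrreducible] (i j : ι) :
    ∃ a, P.pairingIn ℤ a i ≠ 0 ∧ P.pairingIn ℤ a j ≠ 0 := by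
  by_contra! hcon
  let s : Set ι := {a | P.pairingIn ℤ a i ≠ 0}
  have hs : Submodule.span R (P.root '' s) = ⊤ := by
    apply RootPairing.IsIrreducible.eq_top_of_invtSubmodule_reflection (P := P)
    · intro d
      rw [Module.End.mem_invtSubmodule, Submodule.span_le]
      rintro _ ⟨a, ha, rfl⟩
      change P.reflection d (P.root a) ∈ Submodule.span R (P.root '' s)
      by_cases hd : P.pairingIn ℤ d i = 0
      · rw [← P.root_reflectionPerm]
        apply Submodule.subset_span
        refine ⟨_, ?_, rfl⟩
        change P.pairingIn ℤ _ _ ≠ 0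
        rw [pairingIn_reflectionPerm_left, hd, mul_zero, sub_zero]
        exact ha
      · rw [RootPairing.reflection_apply]
        exact sub_mem (Submodule.subset_span ⟨a, ha, rfl⟩)
          (Submodule.smul_mem _ _ (Submodule.subset_span ⟨d, hd, rfl⟩))
    · rw [Submodule.ne_bot_iff]
      exact ⟨P.root i, Submodule.subset_span ⟨i, by simp [s], rfl⟩, P.ne_zero i⟩
  have hle : Submodule.span R (P.root '' s) ≤ LinearMap.ker (P.coroot' j) := by
    rw [Submodule.span_le]
    rintro _ ⟨a, ha, rfl⟩
    have := hcon a ha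
    simp [← P.algebraMap_pairingIn ℤ, this]
  have : P.root j ∈ LinearMap.ker (P.coroot' j) := hle (hs ▸ Submodule.mem_top)
  simp at this

section OrthogonalSequence

variable {k : ℕ} {β : Fin k → ι}

omit [Fintype ι] in
-- By orthogonality, reflecting in `β j` flips the sign of the `j`-th pairing and leaves the others
-- alone.
lemma exists_pairingIn_eq_mul (horth : ∀ i j, i ≠ j → P.pairingIn ℤ (β i) (β j) = 0)
    (ε : Fin k → ℤ) (hε : ∀ i, ε i = 1 ∨ ε i = -1) (a : ι) :
    ∃ a', ∀ i, P.pairingIn ℤ a' (β i) = ε i * P.pairingIn ℤ a (β i) := by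
  classical
  suffices ∀ s : Finset (Fin k), ∃ a', ∀ i, P.pairingIn ℤ a' (β i) =
      if i ∈ s then ε i * P.pairingIn ℤ a (β i) else P.pairingIn ℤ a (β i) by
    simpa using this Finset.univ
  intro s
  induction s using Finset.induction_on with
  | empty => exact ⟨a, by simp⟩
  | insert j s hj ih =>
    obtain ⟨a', ha'⟩ := ih
    rcases hε j with h | h
    · refine ⟨a', fun i ↦ ?_⟩
      rw [ha' i]
      rcases eq_or_ne i j with rfl | hij
      · simp [h]
      · simp [hij]
    · refine ⟨P.reflectionPerm (β j) a', fun i ↦ ?_⟩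
      rw [pairingIn_reflectionPerm_left, ha' i, ha' j]
      rcases eq_or_ne i j with rfl | hij
      · simp [h, hj]; ring
      · simp [hij, horth j i hij.symm]

variable (b : P.Base)

/-- Dominance concerns pairings of the partial sum with simple coroots. As all members have the same
length, exchanging roots and coroots only rescales by a positive ratio; additivity then covers all
positive roots. -/
lemma sum_pairingIn_nonneg [P.IsReduced] (hlong : ∀ i, IsLong P (β i))
    (hdom : ∀ i, IsDominant b (partialSum (P := P) β i)) {a : ι} (ha : b.IsPos a) (i : Fin k) :
    0 ≤ ∑ l ∈ Finset.Iic i, P.pairingIn ℤ a (β l) := by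
  have hsimple : ∀ a ∈ b.support, 0 ≤ ∑ l ∈ Finset.Iic i, P.pairingIn ℤ a (β l) := by
    intro a ha
    obtain ⟨n, hn⟩ := hdom i a ha
    have hn' : ∑ l ∈ Finset.Iic i, P.pairingIn ℤ (β l) a = n := by
      rw [partialSum, map_sum, LinearMap.sum_apply] at hn
      simp only [RootPairing.root_coroot_eq_pairing, ← P.algebraMap_pairingIn ℤ] at hn
      apply Int.cast_injective (α := R)
      simpa using hn
    obtain ⟨ℓ, hpos, hswap, hle⟩ := exists_rootLength P
    have h : (∑ l ∈ Finset.Iic i, P.pairingIn ℤ a (β l)) * ℓ (β i) = n * ℓ a := by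
      rw [← hn', Finset.sum_mul, Finset.sum_mul]
      refine Finset.sum_congr rfl fun l _ ↦ ?_
      rw [le_antisymm (hle _ (hlong l) (β i)) (hle _ (hlong i) (β l)), hswap]
    have h1 := hpos (β i)
    have h2 := hpos a
    by_contra! hneg
    nlinarith
  refine ha.induction_on_add (p := fun a ↦ 0 ≤ ∑ l ∈ Finset.Iic i, P.pairingIn ℤ a (β l))
    hsimple fun a c d hd ha hc ↦ ?_
  simp only [P.pairingIn_eq_add_of_root_eq_add hd, Finset.sum_add_distrib]
  exact add_nonneg ha (hsimple c hc)

/-- The `i`-th partial sum reduces to its last term, so a negative root would have a nonpositive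
pairing there. -/
lemma isPos_of_pairingIn_pos [P.IsReduced] (hlong : ∀ i, IsLong P (β i))
    (hdom : ∀ i, IsDominant b (partialSum (P := P) β i)) {a : ι} {i : Fin k}
    (h0 : ∀ l < i, P.pairingIn ℤ a (β l) = 0) (hi : 0 < P.pairingIn ℤ a (β i)) : b.IsPos a := by
  let _ := P.indexNeg
  by_contra h
  rw [← RootPairing.Base.IsPos.neg_iff_not] at h
  have h1 := sum_pairingIn_nonneg b hlong hdom h i
  rw [Finset.sum_eq_single_of_mem i (by simp)] at h1
  · change 0 ≤ P.pairingIn ℤ (P.reflectionPerm a a) (β i) at h1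
    rw [P.pairingIn_reflectionPerm_self_left] at h1
    omega
  · intro l hl hli
    change P.pairingIn ℤ (P.reflectionPerm a a) (β l) = 0
    rw [P.pairingIn_reflectionPerm_self_left, h0 l (lt_of_le_of_ne (Finset.mem_Iic.1 hl) hli),
      neg_zero]

lemma pairingIn_nonneg_of_isPos [P.IsReduced] (hlong : ∀ i, IsLong P (β i))
    (hdom : ∀ i, IsDominant b (partialSum (P := P) β i)) {a : ι} {i : Fin k}
    (h0 : ∀ l < i, P.pairingIn ℤ a (β l) = 0) (ha : b.IsPos a) : 0 ≤ P.pairingIn ℤ a (β i) := by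
  have h1 := sum_pairingIn_nonneg b hlong hdom ha i
  rwa [Finset.sum_eq_single_of_mem i (by simp)] at h1
  exact fun l hl hli ↦ h0 l (lt_of_le_of_ne (Finset.mem_Iic.1 hl) hli)

/-- A root is orthogonal to all but at most two members of the sequence. -/
lemma pairingIn_eq_zero_of_ne_zero [P.IsReduced] (hlong : ∀ i, IsLong P (β i))
    (horth : ∀ i j, i ≠ j → P.pairingIn ℤ (β i) (β j) = 0)
    (hdom : ∀ i, IsDominant b (partialSum (P := P) β i)) {a : ι} {i j l : Fin k} (hij : i ≠ j)
    (hli : l ≠ i) (hlj : l ≠ j)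
    (hi : P.pairingIn ℤ a (β i) ≠ 0) (hj : P.pairingIn ℤ a (β j) ≠ 0) :
    P.pairingIn ℤ a (β l) = 0 := by
  by_contra hl
  classical
  let s : Finset (Fin k) := {m | P.pairingIn ℤ a (β m) ≠ 0}
  have mem_s {m : Fin k} : m ∈ s ↔ P.pairingIn ℤ a (β m) ≠ 0 := by simp [s]
  let m := s.min' ⟨i, mem_s.2 hi⟩
  have hm : m ∈ s := s.min'_mem _
  have hk : 0 < k := i.pos
  let z : Fin k := ⟨k - 1, by omega⟩
  -- Signs are chosen to make the first nonzero pairing positive and all others nonpositive. Then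
  -- `a'` is positive, yet its full sum of pairings is at most `1 - 1 - 1 < 0`.
  obtain ⟨a', ha'⟩ := exists_pairingIn_eq_mul horth
    (fun q ↦ if q = m then SignType.sign (P.pairingIn ℤ a (β m)) else
      if 0 ≤ P.pairingIn ℤ a (β q) then -1 else 1) (by
        intro q
        have := mem_s.1 hm
        split_ifs
        · rcases lt_or_gt_of_ne this with h | h <;> simp [h]
        · simp
        · simp) a
  have ham : P.pairingIn ℤ a' (β m) = |P.pairingIn ℤ a (β m)| := by
    rw [ha' m]; simp [sign_mul_self]
  have hne {q : Fin k} (hq : q ≠ m) : P.pairingIn ℤ a' (β q) = -|P.pairingIn ℤ a (β q)| := by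
    rw [ha' q]
    simp only [hq, if_false]
    split_ifs with h
    · simp [abs_of_nonneg h]
    · rw [abs_of_neg (by omega)]; ring
  have hpos : b.IsPos a' := by
    refine isPos_of_pairingIn_pos b hlong hdom (i := m) (fun q hq ↦ ?_) ?_
    · rw [hne hq.ne]
      by_contra h
      have : q ∈ s := mem_s.2 (by simpa using h)
      exact absurd (s.min'_le q this) (not_le.2 hq)
    · rw [ham]
      exact abs_pos.2 (mem_s.1 hm)
  have h1 := sum_pairingIn_nonneg b hlong hdom hpos z
  have hz : Finset.Iic z = Finset.univ := by
    ext q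
    simp only [Finset.mem_Iic, Finset.mem_univ, iff_true, Fin.le_def, z]
    omega
  rw [hz, ← Finset.add_sum_erase _ _ (Finset.mem_univ m)] at h1
  obtain ⟨q, q', hqq, hq, hq', hqm, hqm'⟩ : ∃ q q', q ≠ q' ∧ q ∈ s ∧ q' ∈ s ∧ q ≠ m ∧ q' ≠ m := by
    rcases eq_or_ne i m with h | h
    · exact ⟨j, l, hlj.symm, mem_s.2 hj, mem_s.2 hl, h ▸ hij.symm, h ▸ hli⟩
    · rcases eq_or_ne j m with h' | h'
      · exact ⟨i, l, hli.symm, mem_s.2 hi, mem_s.2 hl, h, h' ▸ hlj⟩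
      · exact ⟨i, j, hij, mem_s.2 hi, mem_s.2 hj, h, h'⟩
  have h2 : ∑ x ∈ Finset.univ.erase m, P.pairingIn ℤ a' (β x) ≤
      ∑ x ∈ ({q, q'} : Finset (Fin k)), P.pairingIn ℤ a' (β x) := by
    have hsub : ({q, q'} : Finset (Fin k)) ⊆ Finset.univ.erase m := by
      intro x hx
      simp only [Finset.mem_insert, Finset.mem_singleton] at hx
      rcases hx with rfl | rfl <;> simp [hqm, hqm']
    have := Finset.sum_le_sum_of_subset_of_nonneg (f := fun x ↦ -P.pairingIn ℤ a' (β x)) hsub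
      fun x hx _ ↦ by simp [hne (Finset.ne_of_mem_erase hx)]
    simpa only [Finset.sum_neg_distrib, neg_le_neg_iff] using this
  rw [Finset.sum_pair hqq, hne hqm, hne hqm'] at h2
  have h3 := abs_pos.2 (mem_s.1 hq)
  have h4 := abs_pos.2 (mem_s.1 hq')
  have h5 : P.pairingIn ℤ a' (β m) ≤ 1 := by
    apply pairingIn_le_one_of_isLong (hlong m)
    rintro rfl
    have := hne hqm
    rw [horth m q hqm.symm] at this
    omega
  omega

end OrthogonalSequence

end RootPairings

/-! ### Weyl group symmetry and the heights of the coroots of the sequence. -/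

section RootPairings

variable {ι R M N : Type*} [Fintype ι] [Field R] [CharZero R]
  [AddCommGroup M] [Module R M] [AddCommGroup N] [Module R N]
  {P : RootPairing ι R M N} [P.IsCrystallographic]

section OrthogonalSequence

variable {k : ℕ} {β : Fin k → ι} (b : P.Base)

/-- Some element of the Weyl group exchanges two given members of the sequence, up to signs, and
fixes the others. -/
lemma exists_perm_swap [P.IsReduced] [P.IsIrreducible] (hlong : ∀ i, IsLong P (β i))
    (horth : ∀ i j, i ≠ j → P.pairingIn ℤ (β i) (β j) = 0)
    (hdom : ∀ i, IsDominant b (partialSum (P := P) β i)) {i j : Fin k} (hij : i ≠ j) :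
    ∃ e : ι ≃ ι, (∀ c, |P.pairingIn ℤ (e c) (β i)| = |P.pairingIn ℤ c (β j)|) ∧
      (∀ c, |P.pairingIn ℤ (e c) (β j)| = |P.pairingIn ℤ c (β i)|) ∧
      ∀ l, l ≠ i → l ≠ j → ∀ c, |P.pairingIn ℤ (e c) (β l)| = |P.pairingIn ℤ c (β l)| := by
  obtain ⟨a₀, hi₀, hj₀⟩ := exists_pairingIn_ne_zero (P := P) (β i) (β j)
  obtain ⟨a, ha⟩ := exists_pairingIn_eq_mul horth
    (fun q ↦ if 0 ≤ P.pairingIn ℤ a₀ (β q) then 1 else -1) (by intro q; split_ifs <;> simp) a₀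
  have hi : 0 < P.pairingIn ℤ a (β i) := by rw [ha]; split_ifs <;> omega
  have hj : 0 < P.pairingIn ℤ a (β j) := by rw [ha]; split_ifs <;> omega
  have hi1 : P.pairingIn ℤ a (β i) = 1 := by
    refine le_antisymm (pairingIn_le_one_of_isLong (hlong i) ?_) hi
    rintro rfl
    rw [horth i j hij] at hj
    omega
  have hj1 : P.pairingIn ℤ a (β j) = 1 := by
    refine le_antisymm (pairingIn_le_one_of_isLong (hlong j) ?_) hj
    rintro rfl
    rw [horth j i hij.symm] at hi
    omega
  have hl (l) (hli : l ≠ i) (hlj : l ≠ j) : P.pairingIn ℤ a (β l) = 0 :=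
    pairingIn_eq_zero_of_ne_zero b hlong horth hdom hij hli hlj hi.ne' hj.ne'
  obtain ⟨ℓ, hpos, hswap, hle⟩ := exists_rootLength P
  have hn : P.pairingIn ℤ (β i) a = P.pairingIn ℤ (β j) a := by
    have h1 := hswap (β i) a
    have h2 := hswap (β j) a
    rw [hi1] at h1
    rw [hj1, le_antisymm (hle _ (hlong i) (β j)) (hle _ (hlong j) (β i)), h1] at h2
    exact mul_right_cancel₀ (hpos a).ne' h2
  have key : P.pairingIn ℤ (P.reflectionPerm a (β i)) (β j) = -P.pairingIn ℤ (β i) a := by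
    rw [pairingIn_reflectionPerm_left, horth i j hij, hj1]
    ring
  have hn1 : 0 < P.pairingIn ℤ (β i) a := by
    have h1 := hswap (β i) a
    have h2 := hpos a
    have h3 := hpos (β i)
    by_contra! h
    nlinarith
  -- If `a` is as long as the `β`'s, then `s_a s_{βⱼ} s_{βᵢ} s_a` exchanges `βᵢ` and `βⱼ`. If `a` is
  -- shorter, `s_a βᵢ` pairs with `βⱼ` to at most -2, hence equals `-βⱼ`, and `s_a` alone suffices.
  rcases eq_or_ne (P.pairingIn ℤ (β i) a) 1 with h1 | h1
  · rw [h1] at hn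
    refine ⟨((P.reflectionPerm a).trans (P.reflectionPerm (β i))).trans
      ((P.reflectionPerm (β j)).trans (P.reflectionPerm a)), fun c ↦ ?_, fun c ↦ ?_,
      fun l hli hlj c ↦ ?_⟩
    · simp only [Equiv.trans_apply, pairingIn_reflectionPerm_left, hi1, hj1, h1, ← hn,
        horth i j hij, horth j i hij.symm, P.pairingIn_same]
      congr 1; ring
    · simp only [Equiv.trans_apply, pairingIn_reflectionPerm_left, hi1, hj1, h1, ← hn,
        horth i j hij, P.pairingIn_same]
      congr 1; ring
    · simp only [Equiv.trans_apply, pairingIn_reflectionPerm_left, hl l hli hlj,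
        horth i l hli.symm, horth j l hlj.symm]
      congr 1; ring
  · have h2 : P.reflectionPerm a (β i) = P.reflectionPerm (β j) (β j) := by
      by_contra h
      have := neg_one_le_pairingIn_of_isLong (hlong j) h
      omega
    have h3 (c : ι) : P.pairingIn ℤ c (β i) - P.pairingIn ℤ c a = -P.pairingIn ℤ c (β j) := by
      rw [← P.pairingIn_reflectionPerm_self_right, ← h2, P.pairingIn_reflectionPerm,
        pairingIn_reflectionPerm_left, hi1, mul_one]
    refine ⟨P.reflectionPerm a, fun c ↦ ?_, fun c ↦ ?_, fun l hli hlj c ↦ ?_⟩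
    · rw [pairingIn_reflectionPerm_left, hi1, mul_one, h3, abs_neg]
    · rw [pairingIn_reflectionPerm_left, hj1, mul_one, ← abs_neg]
      congr 1
      linarith [h3 c]
    · rw [pairingIn_reflectionPerm_left, hl l hli hlj, mul_zero, sub_zero]

/-- The involution `g = -s_{βₘ}` preserves the set `B` of terms dropped, because it keeps the
positive pairing with `βₘ`, and it negates the pairing with `βᵢ`. -/
lemma sum_isPos_step [P.IsReduced] [DecidablePred b.IsPos] (hlong : ∀ i, IsLong P (β i))
    (horth : ∀ i j, i ≠ j → P.pairingIn ℤ (β i) (β j) = 0)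
    (hdom : ∀ i, IsDominant b (partialSum (P := P) β i)) {m i : Fin k} (hmi : m < i) :
    ∑ a with b.IsPos a ∧ ∀ l : Fin k, l.val < m.val → P.pairingIn ℤ a (β l) = 0,
        P.pairingIn ℤ a (β i) =
      ∑ a with b.IsPos a ∧ ∀ l : Fin k, l.val < m.val + 1 → P.pairingIn ℤ a (β l) = 0,
        P.pairingIn ℤ a (β i) := by
  classical
  let g (a : ι) : ι := P.reflectionPerm (P.reflectionPerm (β m) a) (P.reflectionPerm (β m) a)
  have hg (a : ι) (l : Fin k) : P.pairingIn ℤ (g a) (β l) =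
      if l = m then P.pairingIn ℤ a (β m) else -P.pairingIn ℤ a (β l) := by
    simp only [g, P.pairingIn_reflectionPerm_self_left, pairingIn_reflectionPerm_left]
    split_ifs with h
    · rw [h, P.pairingIn_same]; ring
    · rw [horth m l (Ne.symm h)]; ring
  have hroot (a : ι) : P.root (g a) = -P.reflection (β m) (P.root a) := by
    rw [P.root_reflectionPerm, P.reflection_apply_self, P.root_reflectionPerm]
  have hgg (a : ι) : g (g a) = a := by
    apply P.root.injective
    rw [hroot, hroot, map_neg, neg_neg, P.reflection_same]
  let B : Finset ι := {a | (b.IsPos a ∧ ∀ l : Fin k, l.val < m.val → P.pairingIn ℤ a (β l) = 0) ∧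
    ¬ P.pairingIn ℤ a (β m) = 0}
  have hB : ∀ a ∈ B, g a ∈ B := by
    intro a ha
    simp only [B, Finset.mem_filter, Finset.mem_univ, true_and] at ha ⊢
    have h0 : ∀ l : Fin k, l.val < m.val → P.pairingIn ℤ (g a) (β l) = 0 := by
      intro l hl
      have : l ≠ m := by rintro rfl; omega
      rw [hg, if_neg this, ha.1.2 l hl, neg_zero]
    refine ⟨⟨isPos_of_pairingIn_pos b hlong hdom (i := m) h0 ?_, h0⟩, ?_⟩
    · rw [hg, if_pos rfl]
      exact lt_of_le_of_ne (pairingIn_nonneg_of_isPos b hlong hdom ha.1.2 ha.1.1) (Ne.symm ha.2)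
    · rw [hg, if_pos rfl]
      exact ha.2
  have hB0 : ∑ a ∈ B, P.pairingIn ℤ a (β i) = 0 := by
    have : ∑ a ∈ B, P.pairingIn ℤ a (β i) = ∑ a ∈ B, -P.pairingIn ℤ a (β i) := by
      refine Finset.sum_nbij' g g hB hB (fun a _ ↦ hgg a) (fun a _ ↦ hgg a) fun a _ ↦ ?_
      rw [hg, if_neg hmi.ne', neg_neg]
    rw [Finset.sum_neg_distrib] at this
    omega
  rw [← Finset.sum_filter_add_sum_filter_not _ (fun a ↦ P.pairingIn ℤ a (β m) = 0),
    Finset.filter_filter, Finset.filter_filter]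
  change _ + ∑ a ∈ B, _ = _
  rw [hB0, add_zero]
  refine Finset.sum_congr (Finset.filter_congr fun a _ ↦ ?_) fun _ _ ↦ rfl
  rw [and_assoc, and_congr_right_iff]
  refine fun _ ↦ ⟨fun h l hl ↦ ?_, fun h ↦ ⟨fun l hl ↦ h l (by omega), h m (by omega)⟩⟩
  rcases eq_or_ne l m with rfl | hlm
  · exact h.2
  · exact h.1 l (by have := Fin.val_ne_of_ne hlm; omega)

lemma sum_isPos_eq [P.IsReduced] [DecidablePred b.IsPos] (hlong : ∀ i, IsLong P (β i))
    (horth : ∀ i j, i ≠ j → P.pairingIn ℤ (β i) (β j) = 0)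
    (hdom : ∀ i, IsDominant b (partialSum (P := P) β i)) (i : Fin k) :
    ∑ a with b.IsPos a, P.pairingIn ℤ a (β i) =
      ∑ a with b.IsPos a ∧ ∀ l < i, P.pairingIn ℤ a (β l) = 0, P.pairingIn ℤ a (β i) := by
  suffices ∀ m ≤ i.val, ∑ a with b.IsPos a, P.pairingIn ℤ a (β i) =
      ∑ a with b.IsPos a ∧ ∀ l : Fin k, l.val < m → P.pairingIn ℤ a (β l) = 0,
        P.pairingIn ℤ a (β i) from this i.val le_rfl
  intro m hm
  induction m with
  | zero => simp
  | succ m ih =>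
    rw [ih (by omega)]
    exact sum_isPos_step b hlong horth hdom (m := ⟨m, by omega⟩) (by rw [Fin.lt_def]; exact hm)

/-- The right-hand side no longer involves the choice of positive roots, so Weyl group symmetries
apply to it. -/
lemma two_mul_sum_isPos [P.IsReduced] [DecidablePred b.IsPos] (hlong : ∀ i, IsLong P (β i))
    (horth : ∀ i j, i ≠ j → P.pairingIn ℤ (β i) (β j) = 0)
    (hdom : ∀ i, IsDominant b (partialSum (P := P) β i)) (i : Fin k) :
    2 * ∑ a with b.IsPos a, P.pairingIn ℤ a (β i) =
      ∑ a with ∀ l < i, P.pairingIn ℤ a (β l) = 0, |P.pairingIn ℤ a (β i)| := by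
  classical
  let _ := P.indexNeg
  have hneg (a x : ι) : P.pairingIn ℤ (-a) x = -P.pairingIn ℤ a x :=
    P.pairingIn_reflectionPerm_self_left ℤ a x
  rw [sum_isPos_eq b hlong horth hdom, two_mul,
    ← Finset.sum_filter_add_sum_filter_not (Finset.filter (fun a ↦ ∀ l < i, _) _) b.IsPos]
  have h1 : ∑ a with b.IsPos a ∧ ∀ l < i, P.pairingIn ℤ a (β l) = 0, P.pairingIn ℤ a (β i) =
      ∑ a with b.IsPos a ∧ ∀ l < i, P.pairingIn ℤ a (β l) = 0, |P.pairingIn ℤ a (β i)| := by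
    refine Finset.sum_congr rfl fun a ha ↦ ?_
    simp only [Finset.mem_filter, Finset.mem_univ, true_and] at ha
    rw [abs_of_nonneg (pairingIn_nonneg_of_isPos b hlong hdom ha.2 ha.1)]
  rw [h1, Finset.filter_filter, Finset.filter_filter]
  congr 1
  · simp only [and_comm]
  · refine Finset.sum_nbij' (fun a ↦ -a) (fun a ↦ -a) ?_ ?_ (fun a _ ↦ neg_neg a)
      (fun a _ ↦ neg_neg a) (fun a _ ↦ by rw [hneg, abs_neg])
    · intro a ha
      simp only [Finset.mem_filter, Finset.mem_univ, true_and] at ha ⊢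
      refine ⟨fun l hl ↦ by rw [hneg, ha.2 l hl, neg_zero], ?_⟩
      rw [← RootPairing.Base.IsPos.neg_iff_not, neg_neg]
      exact ha.1
    · intro a ha
      simp only [Finset.mem_filter, Finset.mem_univ, true_and] at ha ⊢
      refine ⟨?_, fun l hl ↦ by rw [hneg, ha.1 l hl, neg_zero]⟩
      rw [RootPairing.Base.IsPos.neg_iff_not]
      exact ha.2

/-- The heights of the coroots of the sequence form an arithmetic progression. -/
theorem exists_sum_isPos_eq [P.IsReduced] [P.IsIrreducible] [DecidablePred b.IsPos]
    (hlong : ∀ i, IsLong P (β i))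
    (horth : ∀ i j, i ≠ j → P.pairingIn ℤ (β i) (β j) = 0)
    (hdom : ∀ i, IsDominant b (partialSum (P := P) β i)) :
    ∃ c d : ℤ, ∀ i : Fin k, 2 * ∑ a with b.IsPos a, P.pairingIn ℤ a (β i) = c - i.val * d := by
  classical
  -- `T i` runs over all roots; `S l i` keeps those meeting both `β l` and `β i`. Everything is
  -- written in absolute values since the exchanges hold only up to sign.
  let T (i : Fin k) : ℤ := ∑ a, |P.pairingIn ℤ a (β i)|
  let S (l i : Fin k) : ℤ := ∑ a, if |P.pairingIn ℤ a (β l)| = 0 then 0 else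
    |P.pairingIn ℤ a (β i)|
  have hsum (i : Fin k) : 2 * ∑ a with b.IsPos a, P.pairingIn ℤ a (β i) =
      T i - ∑ l ∈ Finset.Iio i, S l i := by
    rw [two_mul_sum_isPos b hlong horth hdom, Finset.sum_filter, Finset.sum_comm,
      ← Finset.sum_sub_distrib]
    refine Finset.sum_congr rfl fun a _ ↦ ?_
    simp only [abs_eq_zero]
    by_cases h0 : P.pairingIn ℤ a (β i) = 0
    · simp [h0]
    split_ifs with h
    · rw [Finset.sum_eq_zero, sub_zero]
      intro l hl
      rw [if_pos (h l (Finset.mem_Iio.1 hl))]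
    -- A root meeting `β i` and an earlier `β l` meets no third member, so it is subtracted exactly
    -- once.
    · push Not at h
      obtain ⟨l, hli, hl⟩ := h
      rw [Finset.sum_eq_single_of_mem l (Finset.mem_Iio.2 hli), if_neg hl, sub_self]
      intro l' hl' hne
      rw [if_pos (pairingIn_eq_zero_of_ne_zero b hlong horth hdom hli.ne hne
        (Finset.mem_Iio.1 hl').ne hl h0)]
  have hT (i j : Fin k) : T i = T j := by
    rcases eq_or_ne i j with rfl | hij
    · rfl
    obtain ⟨e, h1, h2, h3⟩ := exists_perm_swap b hlong horth hdom hij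
    simp only [T]
    rw [← e.sum_comp]
    simp only [h1]
  have hSl {i j l : Fin k} (hil : l ≠ i) (hjl : l ≠ j) : S i l = S j l := by
    rcases eq_or_ne i j with rfl | hij
    · rfl
    obtain ⟨e, h1, h2, h3⟩ := exists_perm_swap b hlong horth hdom hij
    simp only [S]
    rw [← e.sum_comp]
    simp only [h1, h3 l hil hjl]
  have hSr {i j l : Fin k} (hil : l ≠ i) (hjl : l ≠ j) : S l i = S l j := by
    rcases eq_or_ne i j with rfl | hij
    · rfl
    obtain ⟨e, h1, h2, h3⟩ := exists_perm_swap b hlong horth hdom hij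
    simp only [S]
    rw [← e.sum_comp]
    simp only [h1, h3 l hil hjl]
  rcases Nat.lt_or_ge k 2 with hk | hk
  · rcases Nat.eq_zero_or_pos k with rfl | hk0
    · exact ⟨0, 0, fun i ↦ i.elim0⟩
    · refine ⟨T ⟨0, hk0⟩, 0, fun i ↦ ?_⟩
      have : Finset.Iio i = ∅ := by
        ext l
        simp only [Finset.mem_Iio, Fin.lt_def, Finset.notMem_empty, iff_false]
        omega
      rw [hsum, this, Finset.sum_empty, hT i ⟨0, hk0⟩]
      simp
  · let z : Fin k := ⟨0, by omega⟩
    let o : Fin k := ⟨1, by omega⟩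
    refine ⟨T z, S z o, fun i ↦ ?_⟩
    have hS : ∀ l ∈ Finset.Iio i, S l i = S z o := by
      intro l hl
      rw [Finset.mem_Iio] at hl
      have hiz : i ≠ z := (lt_of_le_of_lt (Fin.le_def.2 (Nat.zero_le _)) hl).ne'
      have hoz : z ≠ o := by simp [z, o]
      rw [hSl hl.ne' hiz, hSr hiz.symm hoz]
    rw [hsum, hT i z, Finset.sum_congr rfl hS, Finset.sum_const, Fin.card_Iio, nsmul_eq_mul]

end OrthogonalSequence

end RootPairings

/-! ### The Casimir operator: independence of bases, equivariance, scalar action. -/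

section CasimirOperator

variable {L : Type*} [LieRing L] [LieAlgebra ℂ L] [FiniteDimensional ℂ L]
  (Φ : LinearMap.BilinForm ℂ L) (hΦ : Φ.Nondegenerate)
  {M : Type*} [AddCommGroup M] [Module ℂ M] [LieRingModule L M] [LieModule ℂ L M]

lemma casimir_apply (m : M) : casimir Φ hΦ M m =
    ∑ i, ⁅finBasis ℂ L i, ⁅Φ.dualBasis hΦ (finBasis ℂ L) i, m⁆⁆ := by
  simp [casimir, LinearMap.sum_apply]

lemma eq_sum_dualBasis {V ι : Type*} [AddCommGroup V] [Module ℂ V] [FiniteDimensional ℂ V]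
    [Fintype ι] [DecidableEq ι] (B : LinearMap.BilinForm ℂ V) (hB : B.Nondegenerate)
    (e : Basis ι ℂ V) (x : V) :
    x = ∑ i, B x (e i) • B.dualBasis hB e i := by
  conv_lhs => rw [← (B.dualBasis hB e).sum_repr x]
  simp only [LinearMap.BilinForm.dualBasis_repr_apply]

lemma eq_sum_basis {V ι : Type*} [AddCommGroup V] [Module ℂ V] [FiniteDimensional ℂ V]
    [Fintype ι] [DecidableEq ι] (B : LinearMap.BilinForm ℂ V) (hB : B.Nondegenerate)
    (e : Basis ι ℂ V) (x : V) :
    ∑ i, B (B.dualBasis hB e i) x • e i = x := by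
  have (i : ι) : B (B.dualBasis hB e i) = e.coord i := by
    refine e.ext fun j ↦ ?_
    rw [LinearMap.BilinForm.apply_dualBasis_left, Basis.coord_apply, Basis.repr_self,
      Finsupp.single_apply]
  simp [this, e.sum_repr]

/-- The Casimir operator may be computed in any pair of dual families. -/
lemma casimir_apply_eq_sum {κ : Type*} [Fintype κ] (u w : κ → L)
    (h : ∀ y, ∑ j, Φ (w j) y • u j = y) (m : M) :
    casimir Φ hΦ M m = ∑ j, ⁅u j, ⁅w j, m⁆⁆ := by
  have hw (j : κ) : ⁅u j, ⁅w j, m⁆⁆ = ∑ i, ⁅Φ (w j) (finBasis ℂ L i) • u j,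
      ⁅Φ.dualBasis hΦ (finBasis ℂ L) i, m⁆⁆ := by
    conv_lhs => rw [eq_sum_dualBasis Φ hΦ (finBasis ℂ L) (w j)]
    simp [sum_lie, lie_sum]
  rw [casimir_apply, Finset.sum_congr rfl fun j _ ↦ hw j, Finset.sum_comm]
  refine Finset.sum_congr rfl fun i _ ↦ ?_
  rw [← sum_lie, h]

/-- By invariance of the form, the matrices of `ad x` in the basis and in its dual are negative
transposes, so the two extra Leibniz sums cancel. -/
lemma casimir_lie (hinv : Φ.lieInvariant L) (x : L) (m : M) :
    casimir Φ hΦ M ⁅x, m⁆ = ⁅x, casimir Φ hΦ M m⁆ := by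
  let e := finBasis ℂ L
  let f := Φ.dualBasis hΦ e
  have h1 : ∑ i, ⁅⁅x, e i⁆, ⁅f i, m⁆⁆ = ∑ i, ∑ j, Φ (f j) ⁅x, e i⁆ • ⁅e j, ⁅f i, m⁆⁆ := by
    refine Finset.sum_congr rfl fun i _ ↦ ?_
    conv_lhs => rw [← eq_sum_basis Φ hΦ e ⁅x, e i⁆]
    simp only [sum_lie, smul_lie, f]
  have h2 : ∑ i, ⁅e i, ⁅⁅x, f i⁆, m⁆⁆ = ∑ i, ∑ j, Φ ⁅x, f i⁆ (e j) • ⁅e i, ⁅f j, m⁆⁆ := by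
    refine Finset.sum_congr rfl fun i _ ↦ ?_
    conv_lhs => rw [eq_sum_dualBasis Φ hΦ e ⁅x, f i⁆]
    simp only [sum_lie, smul_lie, lie_sum, lie_smul, f]
  have h3 : ∑ i, ⁅⁅x, e i⁆, ⁅f i, m⁆⁆ + ∑ i, ⁅e i, ⁅⁅x, f i⁆, m⁆⁆ = 0 := by
    rw [h1, h2, Finset.sum_comm, ← Finset.sum_add_distrib]
    refine Finset.sum_eq_zero fun i _ ↦ ?_
    rw [← Finset.sum_add_distrib]
    refine Finset.sum_eq_zero fun j _ ↦ ?_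
    rw [hinv x (f i) (e j), neg_smul, add_neg_cancel]
  rw [casimir_apply, casimir_apply, lie_sum]
  have h4 (i) : ⁅x, ⁅e i, ⁅f i, m⁆⁆⁆ =
      ⁅⁅x, e i⁆, ⁅f i, m⁆⁆ + ⁅e i, ⁅⁅x, f i⁆, m⁆⁆ + ⁅e i, ⁅f i, ⁅x, m⁆⁆⁆ := by
    rw [leibniz_lie x (e i), leibniz_lie x (f i), lie_add, add_assoc]
  change ∑ i, ⁅e i, ⁅f i, ⁅x, m⁆⁆⁆ = ∑ i, ⁅x, ⁅e i, ⁅f i, m⁆⁆⁆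
  simp only [h4, Finset.sum_add_distrib, h3, zero_add]

/-- The eigenspace of an operator commuting with `L` is a submodule; being nonzero, it is
everything. -/
lemma hasCasimirEigenvalue_of_isIrreducible (hinv : Φ.lieInvariant L)
    [LieModule.IsIrreducible ℂ L M] {c : ℂ} {v : M} (hv : v ≠ 0)
    (h : casimir Φ hΦ M v = c • v) : HasCasimirEigenvalue Φ hΦ M c := by
  let N : LieSubmodule ℂ L M :=
    { LinearMap.ker (casimir Φ hΦ M - c • LinearMap.id) with
      lie_mem := by
        intro x m hm
        change casimir Φ hΦ M m - c • m = 0 at hm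
        change casimir Φ hΦ M ⁅x, m⁆ - c • ⁅x, m⁆ = 0
        rw [casimir_lie Φ hΦ hinv, ← lie_smul, ← lie_sub, hm, lie_zero] }
  have hvN : v ∈ N := by
    change casimir Φ hΦ M v - c • v = 0
    rw [h, sub_self]
  have hN : N = ⊤ := by
    refine (IsSimpleOrder.eq_bot_or_eq_top N).resolve_left fun h0 ↦ ?_
    rw [h0] at hvN
    exact hv ((LieSubmodule.mem_bot _).1 hvN)
  intro m
  have : m ∈ N := hN ▸ LieSubmodule.mem_top m
  exact sub_eq_zero.1 (show casimir Φ hΦ M m - c • m = 0 from this)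

end CasimirOperator

/-! ### The invariant form and the root space decomposition. -/

section HighestWeight

variable {L : Type*} [LieRing L] [LieAlgebra ℂ L] [FiniteDimensional ℂ L] [IsSimple ℂ L]
  {H : LieSubalgebra ℂ L} [H.IsCartanSubalgebra]
  {Φ : LinearMap.BilinForm ℂ L}

lemma form_eq_zero_of_mem_rootSpace (hinv : Φ.lieInvariant L) {χ ψ : H → ℂ} (hne : χ + ψ ≠ 0)
    {x y : L} (hx : x ∈ rootSpace H χ) (hy : y ∈ rootSpace H ψ) : Φ x y = 0 := by
  obtain ⟨h, hh⟩ := Function.ne_iff.1 hne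
  have h1 := hinv (h : L) x y
  have hx' : ⁅(h : L), x⁆ = χ h • x := IsKilling.lie_eq_smul_of_mem_rootSpace hx h
  have hy' : ⁅(h : L), y⁆ = ψ h • y := IsKilling.lie_eq_smul_of_mem_rootSpace hy h
  rw [hx', hy', map_smul, map_smul, LinearMap.smul_apply, smul_eq_mul, smul_eq_mul,
    eq_neg_iff_add_eq_zero, ← add_mul] at h1
  exact (mul_eq_zero.1 h1).resolve_left hh

omit [IsSimple ℂ L] in
lemma mem_rootSpace_induction {p : L → Prop} (hp0 : p 0) (hadd : ∀ x y, p x → p y → p (x + y))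
    (hH : ∀ h : H, p h) (hroot : ∀ α : H.root, ∀ x ∈ rootSpace H α.1, p x) (x : L) : p x := by
  have hx : x ∈ ⨆ χ : Weight ℂ H L, rootSpace H χ := by
    rw [iSup_genWeightSpace_eq_top' ℂ H L]
    exact LieSubmodule.mem_top x
  induction hx using LieSubmodule.iSup_induction' with
  | zero => exact hp0
  | mem χ y hy =>
    by_cases hχ : χ.IsZero
    · have : y ∈ H := by
        rw [hχ.eq, rootSpace_zero_eq ℂ L H] at hy
        exact hy
      exact hH ⟨y, this⟩
    · exact hroot ⟨χ, by simpa using hχ⟩ y hy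
  | add y z _ _ hy hz => exact hadd y z hy hz

omit [IsSimple ℂ L] in
lemma coe_mem_rootSpace_zero (h : H) : (h : L) ∈ rootSpace H (0 : H → ℂ) := by
  rw [rootSpace_zero_eq ℂ L H]
  exact h.2

omit [IsSimple ℂ L] in
lemma coe_root_ne_zero (α : H.root) : (α.1 : H → ℂ) ≠ 0 :=
  LieSubalgebra.isNonZero_coe_root α

lemma coe_add_coe_ne_zero {α β : H.root} (h : α.1 ≠ -β.1) : (α.1 : H → ℂ) + (β.1 : H → ℂ) ≠ 0 := by
  intro h0
  apply h
  apply DFunLike.coe_injective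
  rw [LieModule.Weight.coe_neg]
  exact eq_neg_of_add_eq_zero_left h0

lemma restrict_nondegenerate (hΦ : Φ.Nondegenerate) (hsymm : Φ.IsSymm)
    (hinv : Φ.lieInvariant L) : (Φ.restrict H.toSubmodule).Nondegenerate := by
  have hs : (Φ.restrict H.toSubmodule).IsSymm := ⟨fun x y ↦ hsymm.eq x y⟩
  have key : ∀ h : H, (∀ h' : H, Φ h h' = 0) → h = 0 := by
    intro h hh
    have : ∀ y, Φ h y = 0 := mem_rootSpace_induction (H := H) (by simp)
      (fun x y hx hy ↦ by rw [map_add, hx, hy, add_zero]) hh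
      fun α x hx ↦ form_eq_zero_of_mem_rootSpace hinv
        (by rw [zero_add]; exact coe_root_ne_zero α) (coe_mem_rootSpace_zero h) hx
    exact Subtype.ext (hΦ.1 _ this)
  refine ⟨key, fun h hh ↦ key h fun h' ↦ ?_⟩
  rw [hsymm.eq]
  exact hh h'

/-- For every root choose an `sl₂`-triple and normalise it by the form. -/
lemma exists_sl2_form (hΦ : Φ.Nondegenerate) (hinv : Φ.lieInvariant L) (α : H.root) :
    ∃ e f : L, ∃ c : ℂ, e ∈ rootSpace H α.1 ∧ f ∈ rootSpace H (-α.1) ∧ c ≠ 0 ∧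
      Φ e f = c ∧ ⁅e, f⁆ = (IsKilling.coroot α.1 : L) ∧
      ∀ x ∈ rootSpace H α.1, ∃ z : ℂ, x = z • e := by
  have hα := LieSubalgebra.isNonZero_coe_root α
  obtain ⟨h, e, f, ht, he, hf⟩ := IsKilling.exists_isSl2Triple_of_weight_isNonZero hα
  have aux {β : Weight ℂ H L} (hβ : β.IsNonZero) {y g : L}
      (hy : y ∈ rootSpace H β) (hg : g ∈ rootSpace H β) (hg0 : g ≠ 0) : ∃ z : ℂ, y = z • g := by
    obtain ⟨z, hz⟩ := (finrank_eq_one_iff_of_nonzero' ⟨g, hg⟩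
      (by rwa [ne_eq, LieSubmodule.mk_eq_zero])).mp
        (IsKilling.finrank_rootSpace_eq_one β hβ) ⟨y, hy⟩
    exact ⟨z, by simpa using hz.symm⟩
  refine ⟨e, f, Φ e f, he, hf, fun hc ↦ ?_, rfl, ?_,
    fun x hx ↦ aux hα hx he ht.e_ne_zero⟩
  -- Only the line spanned by `f` can pair nontrivially with `e`, so `Φ e f = 0` would put `e` in
  -- the radical.
  · apply ht.e_ne_zero
    apply hΦ.1
    refine mem_rootSpace_induction (H := H) (by simp)
      (fun x y hx hy ↦ by rw [map_add, hx, hy, add_zero])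
      (fun h ↦ form_eq_zero_of_mem_rootSpace hinv
        (by rw [add_zero]; exact coe_root_ne_zero α) he (coe_mem_rootSpace_zero h))
      fun β x hx ↦ ?_
    by_cases hβ : β.1 = -α.1
    · rw [hβ] at hx
      obtain ⟨z, rfl⟩ := aux hα.neg hx hf ht.f_ne_zero
      rw [map_smul, hc, smul_zero]
    · refine form_eq_zero_of_mem_rootSpace hinv (coe_add_coe_ne_zero fun h ↦ hβ ?_) he hx
      rw [h, neg_neg]
  · rw [ht.lie_e_f, ht.h_eq_coroot hα he hf]

end HighestWeight

/-! ### The Casimir operator on highest weight vectors. -/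

section HighestWeight

variable {L : Type*} [LieRing L] [LieAlgebra ℂ L] [FiniteDimensional ℂ L] [IsSimple ℂ L]
  {H : LieSubalgebra ℂ L} [H.IsCartanSubalgebra]
  {Φ : LinearMap.BilinForm ℂ L}

/-- Weights of the Casimir operator on highest weight vectors: `q α` is half the square length
of the root `α`, for the form on the dual of the Cartan subalgebra induced by `Φ`. -/
theorem exists_casimir_eq_smul (b : (IsKilling.rootSystem H).Base) [DecidablePred b.IsPos]
    (hΦ : Φ.Nondegenerate) (hsymm : Φ.IsSymm) (hinv : Φ.lieInvariant L) :
    ∃ q : H.root → ℂ,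
      (∀ α β, q α * (IsKilling.rootSystem H).pairing β α =
        q β * (IsKilling.rootSystem H).pairing α β) ∧
      ∀ {M : Type _} [AddCommGroup M] [Module ℂ M] [LieRingModule L M] [LieModule ℂ L M]
        {n : ℕ} (r : Fin n → H.root) (v : M)
        (_ : ∀ h : H, ⁅(h : L), v⁆ = (∑ s, (IsKilling.rootSystem H).root (r s)) h • v)
        (_ : ∀ α : H.root, b.IsPos α → ∀ x ∈ rootSpace H α.1, ⁅x, v⁆ = 0),
        casimir Φ hΦ M v = (∑ s, (∑ i, q (r i) * (IsKilling.rootSystem H).pairing (r s) (r i) +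
          ∑ α with b.IsPos α, q α * (IsKilling.rootSystem H).pairing (r s) α)) • v := by
  classical
  choose e f c he hf hc0 hec hef hspan using exists_sl2_form (H := H) hΦ hinv
  let B : LinearMap.BilinForm ℂ H := Φ.restrict H.toSubmodule
  have hB : B.Nondegenerate := restrict_nondegenerate hΦ hsymm hinv
  let x := finBasis ℂ H
  let y := B.dualBasis hB x
  have hcoroot (h : H) (α : H.root) : B h (IsKilling.coroot α.1) = c α * α.1 h := by
    have h1 : ⁅(h : L), e α⁆ = α.1 h • e α := IsKilling.lie_eq_smul_of_mem_rootSpace (he α) h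
    have h2 := hinv (e α) h (f α)
    rw [hef, ← lie_skew, h1, map_neg, LinearMap.neg_apply, map_smul, LinearMap.smul_apply, hec,
      neg_inj, smul_eq_mul] at h2
    rw [mul_comm, h2]
    rfl
  -- Dual families adapted to the root decomposition: dual bases of `H`, and `e α` against `(c α)⁻¹
  -- • f α`.
  have hspecial (z : L) : ∑ j : Fin (finrank ℂ H) ⊕ H.root,
      Φ (Sum.elim (fun i ↦ (y i : L)) (fun α ↦ (c α)⁻¹ • f α) j) z •
        Sum.elim (fun i ↦ (x i : L)) e j = z := by
    refine mem_rootSpace_induction (H := H) (p := fun z ↦ ∑ j : Fin (finrank ℂ H) ⊕ H.root,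
      Φ (Sum.elim (fun i ↦ (y i : L)) (fun α ↦ (c α)⁻¹ • f α) j) z •
        Sum.elim (fun i ↦ (x i : L)) e j = z) (by simp only [map_zero, zero_smul,
          Finset.sum_const_zero]) (fun z z' hz hz' ↦ ?_) (fun h ↦ ?_)
      (fun β z hz ↦ ?_) z
    · simp only [map_add, add_smul, Finset.sum_add_distrib, hz, hz']
    · have h1 : ∑ i, B (y i) h • x i = h := eq_sum_basis B hB x h
      have h2 (α : H.root) : Φ (f α) h = 0 := form_eq_zero_of_mem_rootSpace hinv
        (by rw [add_zero, neg_ne_zero]; exact coe_root_ne_zero α) (hf α) (coe_mem_rootSpace_zero h)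
      rw [Fintype.sum_sum_type]
      simp only [Sum.elim_inl, Sum.elim_inr, map_smul, LinearMap.smul_apply, h2, smul_zero,
        zero_smul, Finset.sum_const_zero, add_zero]
      conv_rhs => rw [← h1]
      exact (map_sum H.toSubmodule.subtype (fun i ↦ B (y i) h • x i) Finset.univ).symm
    · obtain ⟨t, rfl⟩ := hspan β z hz
      have h1 (i) : Φ (y i : L) (e β) = 0 := form_eq_zero_of_mem_rootSpace hinv
        (by rw [zero_add]; exact coe_root_ne_zero β) (coe_mem_rootSpace_zero (y i)) (he β)
      have h2 (α : H.root) (hα : α ≠ β) : Φ (f α) (e β) = 0 := by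
        rw [hsymm.eq]
        refine form_eq_zero_of_mem_rootSpace hinv ?_ (he β) (hf α)
        rw [← sub_eq_add_neg, sub_ne_zero]
        exact fun h ↦ hα (Subtype.ext (DFunLike.coe_injective h.symm))
      rw [Fintype.sum_sum_type]
      simp only [Sum.elim_inl, Sum.elim_inr, map_smul, LinearMap.smul_apply, h1, smul_zero,
        zero_smul, Finset.sum_const_zero, zero_add]
      rw [Finset.sum_eq_single_of_mem β (Finset.mem_univ β)
        (fun α _ hα ↦ by rw [h2 α hα, smul_zero, smul_zero, zero_smul]), hsymm.eq, hec,
        smul_eq_mul, smul_eq_mul, inv_mul_cancel₀ (hc0 β), mul_one]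
  refine ⟨fun α ↦ (c α)⁻¹, fun α β ↦ ?_, fun {M} _ _ _ _ n r v hw hpos ↦ ?_⟩
  · have h1 := hcoroot (IsKilling.coroot α.1) β
    have h2 := hcoroot (IsKilling.coroot β.1) α
    rw [show B (IsKilling.coroot α.1) (IsKilling.coroot β.1) =
      B (IsKilling.coroot β.1) (IsKilling.coroot α.1) from hsymm.eq _ _, h2] at h1
    have h3 := hc0 α
    have h4 := hc0 β
    rw [IsKilling.rootSystem_pairing_apply, IsKilling.rootSystem_pairing_apply]
    field_simp
    linear_combination -h1
  · set lam : Dual ℂ H := ∑ s, (IsKilling.rootSystem H).root (r s) with hlam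
    have hlam_coroot (α : H.root) : lam (IsKilling.coroot α.1) =
        ∑ s, (IsKilling.rootSystem H).pairing (r s) α := by
      rw [hlam, LinearMap.sum_apply]
      rfl
    have hcartan : ∑ i, lam (x i) * lam (y i) =
        ∑ s, ∑ i, (c (r i))⁻¹ * (IsKilling.rootSystem H).pairing (r s) (r i) := by
      -- `t` represents the weight `lam` through the form, so the Cartan part of the Casimir is `lam
      -- t`, that is `(λ, λ)`.
      let t : H := ∑ i, (c (r i))⁻¹ • IsKilling.coroot (r i).1
      have h1 (h : H) : lam h = B h t := by
        rw [hlam, LinearMap.sum_apply, map_sum]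
        refine Finset.sum_congr rfl fun s _ ↦ ?_
        rw [map_smul, hcoroot, smul_eq_mul, inv_mul_cancel_left₀ (hc0 _)]
        rfl
      calc ∑ i, lam (x i) * lam (y i) = lam (∑ i, B (y i) t • x i) := by
            rw [map_sum]
            refine Finset.sum_congr rfl fun i _ ↦ ?_
            rw [map_smul, smul_eq_mul, h1 (y i), mul_comm]
        _ = lam t := by rw [eq_sum_basis B hB x t]
        _ = ∑ i, ∑ s, (c (r i))⁻¹ * (IsKilling.rootSystem H).pairing (r s) (r i) := by
            rw [map_sum]
            refine Finset.sum_congr rfl fun i _ ↦ ?_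
            rw [map_smul, smul_eq_mul, hlam_coroot, Finset.mul_sum]
        _ = _ := Finset.sum_comm
    have hroot (α : H.root) : ⁅e α, ⁅f α, v⁆⁆ =
        if b.IsPos α then (∑ s, (IsKilling.rootSystem H).pairing (r s) α) • v else 0 := by
      split_ifs with h
      · rw [leibniz_lie, hpos α h _ (he α), lie_zero, add_zero, hef, hw, hlam_coroot]
      · let _ := (IsKilling.rootSystem H).indexNeg
        rw [← RootPairing.Base.IsPos.neg_iff_not] at h
        have h1 : (((-α : H.root) : Weight ℂ H L) : H → ℂ) = -α.1 := by
          have := (IsKilling.rootSystem H).root_reflectionPerm α α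
          rw [RootPairing.reflection_apply_self] at this
          exact congr_arg (fun (φ : Dual ℂ H) ↦ (φ : H → ℂ)) this
        rw [hpos (-α) h (f α) (by rw [h1]; exact hf α), lie_zero]
    have h1 : ∑ i, ⁅(x i : L), ⁅(y i : L), v⁆⁆ = (∑ i, lam (x i) * lam (y i)) • v := by
      rw [Finset.sum_smul]
      refine Finset.sum_congr rfl fun i _ ↦ ?_
      rw [hw, lie_smul, hw, smul_smul, mul_comm]
    have h2 : ∑ α, ⁅e α, ⁅(c α)⁻¹ • f α, v⁆⁆ = (∑ α with b.IsPos α,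
        ∑ s, (c α)⁻¹ * (IsKilling.rootSystem H).pairing (r s) α) • v := by
      rw [Finset.sum_smul, Finset.sum_filter]
      refine Finset.sum_congr rfl fun α _ ↦ ?_
      rw [smul_lie, lie_smul, hroot]
      split_ifs
      · rw [smul_smul, Finset.mul_sum]
      · rw [smul_zero]
    rw [casimir_apply_eq_sum Φ hΦ _ _ hspecial, Fintype.sum_sum_type]
    change ∑ i, ⁅(x i : L), ⁅(y i : L), v⁆⁆ + ∑ α, ⁅e α, ⁅(c α)⁻¹ • f α, v⁆⁆ = _
    rw [h1, h2, hcartan, Finset.sum_comm (s := Finset.filter _ _), ← add_smul,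
      ← Finset.sum_add_distrib]

/-- The height functional is nonnegative on the closure and positive on positive roots. -/
lemma neg_nsmul_root_notMem_closure {b : (IsKilling.rootSystem H).Base} {α : H.root}
    (hα : b.IsPos α) (n : ℕ) (hn : 0 < n) :
    -(n • (IsKilling.rootSystem H).root α) ∉
      AddSubmonoid.closure ((IsKilling.rootSystem H).root '' b.support) := by
  let φ : Dual ℂ H →ₗ[ℂ] ℂ := b.toWeightBasis.constr ℂ fun _ ↦ 1
  have hφ (i) (hi : i ∈ b.support) : φ ((IsKilling.rootSystem H).root i) = 1 := by
    have := b.toWeightBasis.constr_basis ℂ (fun _ ↦ (1 : ℂ)) ⟨i, hi⟩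
    rwa [RootPairing.Base.toWeightBasis_apply] at this
  have h1 : ∀ v ∈ AddSubmonoid.closure ((IsKilling.rootSystem H).root '' b.support),
      ∃ m : ℕ, φ v = m := by
    intro v hv
    induction hv using AddSubmonoid.closure_induction with
    | mem v hv =>
      obtain ⟨i, hi, rfl⟩ := hv
      exact ⟨1, by rw [hφ i hi, Nat.cast_one]⟩
    | zero => exact ⟨0, by simp⟩
    | add v w _ _ hv hw =>
      obtain ⟨m, hm⟩ := hv
      obtain ⟨m', hm'⟩ := hw
      exact ⟨m + m', by rw [map_add, hm, hm', Nat.cast_add]⟩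
  have h2 : ∃ m : ℕ, φ ((IsKilling.rootSystem H).root α) = m + 1 := by
    refine hα.induction_on_add (p := fun α ↦ ∃ m : ℕ, φ ((IsKilling.rootSystem H).root α) = m + 1)
      (fun i hi ↦ ⟨0, by rw [hφ i hi, Nat.cast_zero, zero_add]⟩) fun i j l hl ⟨m, hm⟩ hj ↦ ?_
    exact ⟨m + 1, by rw [hl, map_add, hm, hφ j hj]; push_cast; ring⟩
  intro hmem
  obtain ⟨m, hm⟩ := h1 _ hmem
  obtain ⟨m', hm'⟩ := h2
  rw [map_neg, map_nsmul, hm', nsmul_eq_mul, neg_eq_iff_add_eq_zero] at hm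
  have : n * (m' + 1) + m = 0 := by exact_mod_cast hm
  have h3 : 0 < n * (m' + 1) := by positivity
  omega

lemma hasHighestWeightVector_self {b : (IsKilling.rootSystem H).Base} {θ : H.root}
    (hθ : ∀ j, RootLE b j θ) :
    HasHighestWeightVector b L ((IsKilling.rootSystem H).root θ) := by
  obtain ⟨e, he, he0⟩ := θ.1.exists_ne_zero
  refine ⟨e, he0, fun h ↦ IsKilling.lie_eq_smul_of_mem_rootSpace he h, fun α hα x hx ↦ ?_⟩
  have hmem : ⁅x, e⁆ ∈ rootSpace H ((α.1 : H → ℂ) + θ.1) :=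
    LieAlgebra.lie_mem_genWeightSpace_of_mem_genWeightSpace hx he
  by_contra hne
  have hbot : rootSpace H ((α.1 : H → ℂ) + θ.1) ≠ ⊥ := by
    intro h
    rw [h] at hmem
    exact hne ((LieSubmodule.mem_bot _).1 hmem)
  let χ : Weight ℂ H L := ⟨_, hbot⟩
  -- If `α + θ = 0`, maximality of `θ` against `α` puts `-2α` in the positive cone; otherwise `α +
  -- θ` is a root and maximality against it puts `-α` there.
  by_cases hχ : χ.IsZero
  · refine neg_nsmul_root_notMem_closure hα 2 two_pos ?_
    have := hθ α
    rw [RootLE] at this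
    convert this using 1
    ext h
    have h0 : α.1 h + θ.1 h = 0 := congr_fun hχ h
    change -(2 • α.1 h) = θ.1 h - α.1 h
    rw [two_nsmul]
    linear_combination -h0
  · refine neg_nsmul_root_notMem_closure hα 1 one_pos ?_
    have := hθ ⟨χ, by simpa using hχ⟩
    rw [RootLE] at this
    convert this using 1
    ext h
    change -(1 • α.1 h) = θ.1 h - (α.1 h + θ.1 h)
    rw [one_nsmul]
    ring

end HighestWeight

/-! ### Specialization to sums of orthogonal long roots. -/

section RootPairings

variable {ι R M N : Type*} [Fintype ι] [Field R] [CharZero R]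
  [AddCommGroup M] [Module R M] [AddCommGroup N] [Module R N]
  {P : RootPairing ι R M N} [P.IsCrystallographic]

/-- A function proportional to the square length takes equal values on long roots. -/
lemma eq_of_isLong [P.IsIrreducible] {q : ι → R}
    (hq : ∀ i j, q i * P.pairing j i = q j * P.pairing i j) {i j : ι}
    (hi : IsLong P i) (hj : IsLong P j) : q i = q j := by
  obtain ⟨ℓ, hpos, hswap, hle⟩ := exists_rootLength P
  obtain ⟨a, hai, haj⟩ := exists_pairingIn_ne_zero (P := P) i j
  have key (l : ι) (hl : P.pairingIn ℤ a l ≠ 0) : q l * ℓ a = q a * ℓ l := by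
    have h1 := hq l a
    have h2 : (P.pairingIn ℤ a l : R) * ℓ l = P.pairingIn ℤ l a * ℓ a := by
      exact_mod_cast congr_arg (Int.cast (R := R)) (hswap l a)
    simp only [← P.algebraMap_pairingIn ℤ, eq_intCast] at h1
    have h3 : (P.pairingIn ℤ a l : R) ≠ 0 := Int.cast_ne_zero.2 hl
    apply mul_left_cancel₀ h3
    linear_combination (ℓ a : R) * h1 - q a * h2
  have h1 := key i hai
  rw [le_antisymm (hle j hj i) (hle i hi j), ← key j haj] at h1
  exact mul_right_cancel₀ (Int.cast_ne_zero.2 (hpos a).ne') h1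

end RootPairings

section HighestWeight

variable {L : Type*} [LieRing L] [LieAlgebra ℂ L] [FiniteDimensional ℂ L] [IsSimple ℂ L]
  {H : LieSubalgebra ℂ L} [H.IsCartanSubalgebra]

lemma IsHighestOrthogonalSequence.pairingIn_eq_zero {b : (IsKilling.rootSystem H).Base} {k : ℕ}
    {r : Fin k → H.root} (hr : IsHighestOrthogonalSequence b r) (i j : Fin k) (hij : i ≠ j) :
    (IsKilling.rootSystem H).pairingIn ℤ (r i) (r j) = 0 := by
  have key : (IsKilling.rootSystem H).pairing (r i) (r j) = 0 := by
    rcases lt_or_gt_of_ne hij with h | h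
    · exact (hr.orthogonal j i h).2
    · exact (hr.orthogonal i j h).1
  rw [← (IsKilling.rootSystem H).algebraMap_pairingIn ℤ] at key
  simpa using key

/-- The Casimir operator on a vector of highest weight `∑ i, r (g i)`, for a sequence `r` of long
orthogonal roots with dominant partial sums. -/
theorem exists_casimir_eq_sum_smul (b : (IsKilling.rootSystem H).Base)
    (Φ : LinearMap.BilinForm ℂ L) (hΦ : Φ.Nondegenerate) (hsymm : Φ.IsSymm)
    (hinv : Φ.lieInvariant L) {k : ℕ} {r : Fin k → H.root}
    (hr : IsHighestOrthogonalSequence b r)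
    (hdom : ∀ i : Fin k, IsDominant b (partialSum (P := IsKilling.rootSystem H) r i)) :
    ∃ c d : ℂ, ∀ {M : Type _} [AddCommGroup M] [Module ℂ M] [LieRingModule L M] [LieModule ℂ L M]
      {n : ℕ} (g : Fin n ↪ Fin k) (μ : Dual ℂ H)
      (_ : μ = ∑ s, (IsKilling.rootSystem H).root (r (g s)))
      (_ : HasHighestWeightVector b M μ),
      ∃ v : M, v ≠ 0 ∧ casimir Φ hΦ M v = (∑ s, (c - (g s).val * d)) • v := by
  classical
  have horth := hr.pairingIn_eq_zero
  obtain ⟨q, hq, hcas⟩ := exists_casimir_eq_smul b hΦ hsymm hinv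
  obtain ⟨c, d, hcd⟩ := exists_sum_isPos_eq b hr.long horth hdom
  obtain ⟨Q, hQ⟩ : ∃ Q : ℂ, ∀ i, q (r i) = Q := by
    rcases k.eq_zero_or_pos with rfl | hk
    · exact ⟨0, fun i ↦ i.elim0⟩
    · exact ⟨q (r ⟨0, hk⟩), fun i ↦ eq_of_isLong hq (hr.long i) (hr.long _)⟩
  -- With `Q` half the square length of a long root, `(βᵢ, βᵢ) = 2Q` and `(βᵢ, 2ρ) = Q (c - i d) /
  -- 2`. The constants precede the module, so they can be read off from one module and used in
  -- another.
  refine ⟨Q * (2 + c / 2), Q * d / 2, fun {M} _ _ _ _ n g μ hμ hv ↦ ?_⟩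
  obtain ⟨v, hv0, hw, hpos⟩ := hv
  subst hμ
  refine ⟨v, hv0, ?_⟩
  rw [hcas (fun s ↦ r (g s)) v hw hpos]
  congr 1
  refine Finset.sum_congr rfl fun s _ ↦ ?_
  have h1 : ∑ i, q (r (g i)) * (IsKilling.rootSystem H).pairing (r (g s)) (r (g i)) = Q * 2 := by
    rw [Finset.sum_eq_single_of_mem s (Finset.mem_univ s), hQ, RootPairing.pairing_same]
    intro i _ hi
    rw [← (IsKilling.rootSystem H).algebraMap_pairingIn ℤ,
      horth _ _ (fun h ↦ hi (g.injective h).symm), map_zero, mul_zero]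
  have h2 : ∑ α with b.IsPos α, q α * (IsKilling.rootSystem H).pairing (r (g s)) α =
      Q * ((∑ α with b.IsPos α, (IsKilling.rootSystem H).pairingIn ℤ α (r (g s)) : ℤ) : ℂ) := by
    rw [Int.cast_sum, Finset.mul_sum]
    refine Finset.sum_congr rfl fun α _ ↦ ?_
    rw [hq, hQ, ← (IsKilling.rootSystem H).algebraMap_pairingIn ℤ, eq_intCast]
  have h3 : 2 * ((∑ α with b.IsPos α,
      (IsKilling.rootSystem H).pairingIn ℤ α (r (g s)) : ℤ) : ℂ) = c - (g s).val * d := by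
    exact_mod_cast congr_arg (Int.cast (R := ℂ)) (hcd (g s))
  rw [h1, h2]
  linear_combination (Q / 2) * h3

end HighestWeight

end CasimirSeries
end

theorem mainTheorem9 {L : Type*} [LieRing L] [LieAlgebra ℂ L] [FiniteDimensional ℂ L]
    [LieAlgebra.IsSimple ℂ L]
    (H : LieSubalgebra ℂ L) [H.IsCartanSubalgebra]
    (b : (LieAlgebra.IsKilling.rootSystem H).Base)
    (Φ : LinearMap.BilinForm ℂ L) (hΦ : Φ.Nondegenerate) (hsymm : Φ.IsSymm)
    (hinv : Φ.lieInvariant L)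
    (k : ℕ) (hk : 0 < k) (r : Fin k → H.root)
    (hr : CasimirSeries.IsHighestOrthogonalSequence b r)
    (hdom : ∀ i : Fin k, CasimirSeries.IsDominant b
      (CasimirSeries.partialSum (P := LieAlgebra.IsKilling.rootSystem H) r i))
    (t β : ℂ) (ht : CasimirSeries.HasCasimirEigenvalue Φ hΦ L (2 * t))
    (hβ : ∀ h2 : 2 ≤ k,
      CasimirSeries.IsVogelParameter b Φ hΦ t β (r ⟨0, hk⟩) (r ⟨1, h2⟩))
    (Y : LieSubmodule ℂ L (SymmetricAlgebra ℂ L))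
    (hY : CasimirSeries.IsComponent b k
      (∑ i, (LieAlgebra.IsKilling.rootSystem H).root (r i)) Y) :
    CasimirSeries.HasCasimirEigenvalue Φ hΦ Y (2 * k * t - k * (k - 1) * β) := by
  obtain ⟨c, d, hcd⟩ := CasimirSeries.exists_casimir_eq_sum_smul b Φ hΦ hsymm hinv hr hdom
  -- The adjoint representation is the one-term case.
  have hc : c = 2 * t := by
    obtain ⟨v, hv0, hv⟩ := hcd (M := L) (Fin.castLEEmb (Nat.succ_le_of_lt hk)) _ (by simp; rfl)
      (CasimirSeries.hasHighestWeightVector_self (hr.first ⟨0, hk⟩ rfl))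
    rw [ht v] at hv
    simpa using (smul_left_injective ℂ hv0 hv).symm
  -- The two-term case reads `c + (c - d) = 4t - 2β`.
  have hd (h2 : 2 ≤ k) : d = 2 * β := by
    obtain ⟨Y₂, hY₂, hβ₂⟩ := hβ h2
    obtain ⟨v, hv0, hv⟩ := hcd (M := Y₂) (Fin.castLEEmb h2) _ (by rw [Fin.sum_univ_two]; rfl)
      hY₂.highestWeight
    rw [hβ₂ v] at hv
    have := smul_left_injective ℂ hv0 hv
    rw [Fin.sum_univ_two] at this
    simp at this
    linear_combination this + 2 * hc
  obtain ⟨v, hv0, hv⟩ := hcd (M := Y) (Function.Embedding.refl (Fin k)) _ rfl hY.highestWeight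
  have := hY.irreducible
  refine CasimirSeries.hasCasimirEigenvalue_of_isIrreducible Φ hΦ hinv hv0 (hv.trans ?_)
  congr 1
  have hsum : ∑ s : Fin k, ((s.val : ℕ) : ℂ) = k * (k - 1) / 2 := by
    rw [Fin.sum_univ_eq_sum_range (fun i ↦ (i : ℂ)), ← Nat.cast_sum, Finset.sum_range_id,
      Nat.cast_div (Nat.even_mul_pred_self k).two_dvd two_ne_zero, Nat.cast_mul,
      Nat.cast_pred hk, Nat.cast_two]
  change ∑ s : Fin k, (c - (s.val : ℂ) * d) = _
  rw [Finset.sum_sub_distrib, Finset.sum_const, ← Finset.sum_mul, hsum, Finset.card_univ,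
    Fintype.card_fin, nsmul_eq_mul, hc]
  rcases Nat.lt_or_ge k 2 with h2 | h2
  -- Here `d` is undetermined, but its coefficient `k(k-1)/2` vanishes.
  · obtain rfl : k = 1 := by omega
    simp
  · rw [hd h2]
    ring
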